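/- Fix integers $n,d_0\ge 0$. A graph on $n$ nodes is a pair $[X,A]$ of node features $X\in\mathbb R^{n\times d_0}$ and an adjacency matrix $A\in\mathbb R^{n\times n}$ (arbitrary real weights are allowed). Let $\Omega\subset\mathbb R^{n\times d_0}\times\mathbb R^{n\times n}$ be a compact set of graphs and let $f:\Omega\to\mathbb R$ be continuous and permutation invariant, i.e. $f([PX,PAP^T])=f([X,A])$ for every permutation matrix $P\in\mathbb R^{n\times n}$ whenever both graphs lie in $\Omega$. Let $\mathcal D$ be a probability distribution on $\mathbb R$ that is bounded ($|x|\le M$ almost surely for some $M$), with mean zero and variance $c>0$. A multilayer perceptron (MLP) here is a map $x\mapsto W_2\,\mathrm{ReLU}(W_1x+b_1)+b_2$ with a hidden layer of arbitrary finite width. A GNN here consists of one message passing layer followed by a DeepSets global block: on a graph with adjacency matrix $A$ and node features $h_1,\dots,h_n$ it computes $$h_v'=\mathrm{upd}\Big(h_v,\ \sum_{w=1}^n A_{vw}\,\mathrm{msg}(h_w)\Big),\qquad \mathrm{GNN}=\rho\Big(\sum_{v=1}^n\varphi(h'_v)\Big)\in\mathbb R,$$ where $\mathrm{msg},\mathrm{upd},\varphi,\rho$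 are MLPs, with arbitrary finite dimensions of the messages, of the $h'_v$ and of the values of $\varphi$. The random graph neural network (RGNN) with random-feature dimension $d$ is such a GNN, run on the graph $[X,A]$ with input node features $[X,R]\in\mathbb R^{n\times(d_0+d)}$, where the entries of $R\in\mathbb R^{n\times d}$ are i.i.d. samples from $\mathcal D$. Then RGNN is universal in probability: for all $\varepsilon,\delta>0$ there exist $d\in\mathbb N$ and parameters of a GNN (including its widths and intermediate dimensions), depending on neither the graph nor the sample $R$, such that for every graph $[X,A]\in\Omega$ $$P_R\big(\,|\mathrm{GNN}([X,R])-f([X,A])|<\varepsilon\,\big)>1-\delta .$$ -/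

import Mathlib

open MeasureTheory ProbabilityTheory

noncomputable section

namespace RGNN

/-- The parameters of a two-layer perceptron (one hidden layer of arbitrary finite width) from
`ℝ^ι` to `ℝ^κ`. -/
structure MLP (ι κ : Type) where
  /-- number of hidden units -/
  width : ℕ
  /-- weights of the hidden layer -/
  W₁ : Matrix (Fin width) ι ℝ
  /-- biases of the hidden layer -/
  b₁ : Fin width → ℝ
  /-- weights of the output layer -/
  W₂ : Matrix κ (Fin width) ℝ
  /-- biases of the output layer -/
  b₂ : κ → ℝ

/-- The function `x ↦ W₂ ReLU(W₁ x + b₁) + b₂` computed by the perceptron. -/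
def MLP.eval {ι κ : Type} [Fintype ι] (m : MLP ι κ) (x : ι → ℝ) : κ → ℝ :=
  m.W₂.mulVec (fun k => max 0 (m.W₁.mulVec x k + m.b₁ k)) + m.b₂

/-- A perceptron operating on the feature dimension: it is applied to every row (node feature
vector) separately, with shared parameters. -/
def MLP.rowwise {ι κ ν : Type} [Fintype ι] (m : MLP ι κ) (H : Matrix ν ι ℝ) : Matrix ν κ ℝ :=
  Matrix.of fun v => m.eval (H v)

/-- The parameters of a message passing layer with node features `ℝ^ι` in and `ℝ^κ` out. -/
structure MessagePassing (ι κ : Type) where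
  /-- dimension of the messages -/
  msgDim : ℕ
  /-- the message function -/
  msg : MLP ι (Fin msgDim)
  /-- the update function, which sees the node's own feature and its aggregated messages -/
  upd : MLP (ι ⊕ Fin msgDim) κ

/-- One message passing step on a graph with adjacency matrix `A` and node features `H`:
`h'_v = upd (h_v, ∑ w, A v w • msg (h_w))`. -/
def MessagePassing.eval {ι κ ν : Type} [Fintype ι] [Fintype ν] (L : MessagePassing ι κ)
    (A : Matrix ν ν ℝ) (H : Matrix ν ι ℝ) : Matrix ν κ ℝ :=
  L.upd.rowwise (Matrix.fromCols H (A * L.msg.rowwise H))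

/-- The parameters of a DeepSets network (global attribute block) on sets of vectors in `ℝ^κ`,
with one real output. -/
structure DeepSets (κ : Type) where
  /-- dimension of the pooled representation -/
  latentDim : ℕ
  /-- the network applied to every element of the set -/
  phi : MLP κ (Fin latentDim)
  /-- the network applied to the sum -/
  rho : MLP (Fin latentDim) (Fin 1)

/-- The DeepSets function `H ↦ rho (∑ v, phi (h_v))`. -/
def DeepSets.eval {κ ν : Type} [Fintype κ] [Fintype ν] (D : DeepSets κ) (H : Matrix ν κ ℝ) : ℝ :=
  D.rho.eval (∑ v, D.phi.eval (H v)) 0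

/-- The parameters of a graph neural network with input node features in `ℝ^ι`, consisting of a
single message passing layer followed by a DeepSets network. -/
structure GNN (ι : Type) where
  /-- dimension of the node features after the message passing layer -/
  hiddenDim : ℕ
  /-- the message passing layer -/
  layer : MessagePassing ι (Fin hiddenDim)
  /-- the global attribute block -/
  readout : DeepSets (Fin hiddenDim)

/-- The output of the network on a graph with adjacency matrix `A` and node features `H`. -/
def GNN.eval {ι ν : Type} [Fintype ι] [Fintype ν] (N : GNN ι)
    (A : Matrix ν ν ℝ) (H : Matrix ν ι ℝ) : ℝ :=
  N.readout.eval (N.layer.eval A H)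

/-- Graphs `[X, A]` on `n` nodes with node features `X` in `ℝ^(n × d₀)` and (possibly weighted)
adjacency matrix `A` in `ℝ^(n × n)`. -/
abbrev Graph (n d₀ : ℕ) : Type :=
  Matrix (Fin n) (Fin d₀) ℝ × Matrix (Fin n) (Fin n) ℝ

/-- Relabelling of the nodes, `[X, A] ↦ [P X, P A Pᵀ]`, where `P` is the permutation matrix
with `(P X) i = X (σ i)`. -/
def Graph.permute {n d₀ : ℕ} (σ : Equiv.Perm (Fin n)) (G : Graph n d₀) : Graph n d₀ :=
  (G.1.submatrix σ id, G.2.submatrix σ σ)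

/-- The law of an `n × d` array of i.i.d. random features with distribution `μ`. -/
def featureLaw (μ : Measure ℝ) (n d : ℕ) : Measure (Fin n → Fin d → ℝ) :=
  Measure.pi fun _ => Measure.pi fun _ => μ

/-- The random graph neural network: the network `N` run on the graph `G = [X, A]`, with the
sampled features `R` appended to the node features, i.e. with input `[X, R]`. -/
def rgnn {n d₀ d : ℕ} (N : GNN (Fin d₀ ⊕ Fin d)) (G : Graph n d₀) (R : Fin n → Fin d → ℝ) : ℝ :=
  N.eval G.2 (Matrix.fromCols G.1 (Matrix.of R))

end RGNN

end

/-! A single message passing layer computes the rows of `[X, R, A R]` exactly. If `R` has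
independent rows, `A R` determines `A` because `R Rᵀ` can be cancelled, so the multiset of these
rows determines `[X, A]` up to relabelling (`eq_permute_of_nodeFeatures`). Sums of perceptrons over
nodes separate multisets (`exists_perm_of_sum_eval_eq`), hence `f` is constant wherever all pooled
sums agree. On a compact set, Stone–Weierstrass then approximates `f` by a polynomial in pooled
sums, and that polynomial by the perceptron `ρ`. Compactness comes from restricting to bounded `R`
with `det (R Rᵀ) ≥ η`. By Chebyshev, `R Rᵀ / d` is close to `c • 1` for large `d`, so this set of
`R` has probability above `1 - δ`; it does not involve the graph, which makes the result uniform
over `Ω` (`exists_det_gram_ge`). -/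

noncomputable section

namespace RGNN

/-! ### Density of ReLU perceptrons in `C(K, ℝ)` -/

section UniversalApproximation

variable {ι : Type} [Fintype ι]

/-- The affine functional `x ↦ w ⬝ᵥ x + b`, restricted to `K`. -/
def affineMap (K : Set (ι → ℝ)) (w : ι → ℝ) (b : ℝ) : C(K, ℝ) where
  toFun x := w ⬝ᵥ (x : ι → ℝ) + b
  continuous_toFun := 
    (continuous_const.dotProduct continuous_subtype_val).add continuous_const

/-- A single hidden unit, restricted to `K`. -/
def reluRidge (K : Set (ι → ℝ)) (w : ι → ℝ) (b : ℝ) : C(K, ℝ) :=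
  ⟨fun x => max 0 (affineMap K w b x), by fun_prop⟩

/-- The exponential of a linear functional, restricted to `K`. -/
def expRidge (K : Set (ι → ℝ)) (w : ι → ℝ) : C(K, ℝ) :=
  ⟨fun x => Real.exp (affineMap K w 0 x), by fun_prop⟩

/-- The functions on `K` computed by scalar perceptrons. -/
def reluSpan (K : Set (ι → ℝ)) : Submodule ℝ C(K, ℝ) :=
  Submodule.span ℝ (Set.range fun p : (ι → ℝ) × ℝ => reluRidge K p.1 p.2)

theorem reluRidge_mem (K : Set (ι → ℝ)) (w : ι → ℝ) (b : ℝ) : reluRidge K w b ∈ reluSpan K :=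
  Submodule.subset_span ⟨(w, b), rfl⟩

theorem affineMap_mem (K : Set (ι → ℝ)) (w : ι → ℝ) (b : ℝ) : affineMap K w b ∈ reluSpan K := by
  have h : affineMap K w b = reluRidge K w b - reluRidge K (-w) (-b) := by
    ext x
    have h1 : affineMap K (-w) (-b) x = -affineMap K w b x := by
      simp [affineMap]; ring
    simp only [reluRidge, ContinuousMap.sub_apply, ContinuousMap.coe_mk, h1]
    rcases le_total 0 (affineMap K w b x) with h | h
    · rw [max_eq_right h, max_eq_left (by linarith)]; ring
    · rw [max_eq_left h, max_eq_right (by linarith)]; ring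
  rw [h]
  exact sub_mem (reluRidge_mem K w b) (reluRidge_mem K (-w) (-b))

/-- Taylor's formula for `exp`, with the remainder a superposition of shifted `ReLU`s. -/
theorem exp_eq_integral_relu {T t : ℝ} (h₁ : -T ≤ t) (h₂ : t ≤ T) :
    Real.exp t = Real.exp (-T) * (t + (1 + T)) +
      ∫ s in (-T)..T, Real.exp s * max 0 (t - s) := by
  have hc : Continuous fun s : ℝ => Real.exp s * max 0 (t - s) := by fun_prop
  rw [← intervalIntegral.integral_add_adjacent_intervals (b := t)
    (hc.intervalIntegrable _ _) (hc.intervalIntegrable _ _)]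
  have h3 : ∫ s in t..T, Real.exp s * max 0 (t - s) = 0 := by
    rw [intervalIntegral.integral_congr (g := fun _ => (0 : ℝ))]
    · simp
    · intro s hs
      rw [Set.uIcc_of_le h₂] at hs
      simp [max_eq_left (sub_nonpos.2 hs.1)]
  have h4 : ∫ s in (-T)..t, Real.exp s * max 0 (t - s)
      = ∫ s in (-T)..t, Real.exp s * (t - s) := by
    refine intervalIntegral.integral_congr fun s hs => ?_
    rw [Set.uIcc_of_le h₁] at hs
    simp [max_eq_right (sub_nonneg.2 hs.2)]
  have h5 : ∫ s in (-T)..t, Real.exp s * (t - s)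
      = Real.exp t * (t - t + 1) - Real.exp (-T) * (t - -T + 1) := by
    refine intervalIntegral.integral_eq_sub_of_hasDerivAt
      (f := fun s => Real.exp s * (t - s + 1)) (fun s _ => ?_)
      (Continuous.intervalIntegrable (by fun_prop) _ _)
    have := (Real.hasDerivAt_exp s).mul (((hasDerivAt_id s).const_sub t).add_const 1)
    refine this.congr_deriv ?_
    simp
    ring
  rw [h3, h4, h5]
  ring

/-- The average of `F` stays in a closed convex set; multiplying by the length `b - a` stays in the
subspace. -/
theorem intervalIntegral_mem_of_isClosed {E : Type*} [NormedAddCommGroup E] [NormedSpace ℝ E]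
    [CompleteSpace E] {S : Submodule ℝ E} (hS : IsClosed (S : Set E)) {F : ℝ → E}
    (hF : Continuous F) (hFS : ∀ s, F s ∈ S) {a b : ℝ} (hab : a < b) :
    ∫ s in a..b, F s ∈ S := by
  have h := S.convex.set_average_mem hS (μ := volume) (t := Set.Ioc a b) (f := F)
    (by simp [hab]) (by simp) (.of_forall hFS) (hF.integrableOn_Ioc)
  rw [setAverage_eq] at h
  rw [intervalIntegral.integral_of_le hab.le]
  have h2 := S.smul_mem (b - a) h
  rw [SetLike.mem_coe] at h
  convert h2
  have : volume.real (Set.Ioc a b) = b - a := by simp [hab.le]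
  rw [this, smul_inv_smul₀ (sub_pos.2 hab).ne']

theorem continuous_reluRidge_smul (K : Set (ι → ℝ)) (w : ι → ℝ) :
    Continuous fun s : ℝ => Real.exp s • reluRidge K w (-s) := by
  refine ContinuousMap.continuous_of_continuous_uncurry _ ?_
  have h : Continuous fun p : ℝ × K => w ⬝ᵥ (p.2 : ι → ℝ) + -p.1 :=
    (continuous_const.dotProduct (continuous_subtype_val.comp continuous_snd)).add
      continuous_fst.neg
  exact (Real.continuous_exp.comp continuous_fst).smul (continuous_const.max h)

variable {K : Set (ι → ℝ)} [CompactSpace K]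

/-- With `T` bounding the functional on `K`, Taylor's formula becomes an identity in `C(K, ℝ)`: an
affine term plus a Bochner integral of hidden units. -/
theorem expRidge_mem_closure (w : ι → ℝ) :
    expRidge K w ∈ (reluSpan K).topologicalClosure := by
  obtain ⟨T, hT0, hT⟩ : ∃ T : ℝ, 0 < T ∧ ∀ x : K, |affineMap K w 0 x| ≤ T := by
    refine ⟨‖affineMap K w 0‖ + 1, by positivity, fun x => ?_⟩
    have := (affineMap K w 0).norm_coe_le_norm x
    rw [Real.norm_eq_abs] at this
    linarith
  have h : expRidge K w = Real.exp (-T) • affineMap K w (1 + T) +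
      ∫ s in (-T)..T, Real.exp s • reluRidge K w (-s) := by
    ext x
    have hev := (ContinuousMap.evalCLM ℝ x).intervalIntegral_comp_comm
      ((continuous_reluRidge_smul K w).intervalIntegrable (μ := volume) (-T) T)
    simp only [ContinuousMap.evalCLM_apply] at hev
    rw [ContinuousMap.add_apply, ← hev]
    have hx := abs_le.1 (hT x)
    have := exp_eq_integral_relu hx.1 hx.2
    simpa [expRidge, reluRidge, affineMap, sub_eq_add_neg] using this
  rw [h]
  refine add_mem (Submodule.smul_mem _ _ (Submodule.le_topologicalClosure _ (affineMap_mem K w (1 + T)))) ?_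
  exact intervalIntegral_mem_of_isClosed (Submodule.isClosed_topologicalClosure _)
    (continuous_reluRidge_smul K w)
    (fun s => Submodule.smul_mem _ _ (Submodule.le_topologicalClosure _ (reluRidge_mem K w (-s))))
    (by linarith)

/-- Exponentials of linear functionals are closed under products, so the algebra they generate is
merely their linear span. -/
theorem adjoin_expRidge_le_closure :
    (Algebra.adjoin ℝ (Set.range (expRidge K))).toSubmodule ≤
      (reluSpan K).topologicalClosure := by
  have hclosed : (Submonoid.closure (Set.range (expRidge K)) : Set C(K, ℝ)) ⊆
      Set.range (expRidge K) := by
    intro g hg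
    induction hg using Submonoid.closure_induction with
    | mem x hx => exact hx
    | one => exact ⟨0, by ext x; simp [expRidge, affineMap]⟩
    | mul x y _ _ hx hy =>
      obtain ⟨u, rfl⟩ := hx
      obtain ⟨v, rfl⟩ := hy
      exact ⟨u + v, by ext x; simp [expRidge, affineMap, Real.exp_add]⟩
  rw [Algebra.adjoin_eq_span]
  refine Submodule.span_le.2 fun g hg => ?_
  obtain ⟨w, rfl⟩ := hclosed hg
  exact expRidge_mem_closure w

/-- Universal approximation: the closure of the scalar perceptrons is everything. -/
theorem reluSpan_topologicalClosure : (reluSpan K).topologicalClosure = ⊤ := by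
  have hsep : (Algebra.adjoin ℝ (Set.range (expRidge K))).SeparatesPoints := by
    rintro ⟨x, hx⟩ ⟨y, hy⟩ hxy
    -- The direction `x - y` separates, since `(x - y) ⬝ᵥ (x - y) ≠ 0`.
    refine ⟨_, ⟨expRidge K (x - y), Algebra.subset_adjoin ⟨_, rfl⟩, rfl⟩, fun h => hxy ?_⟩
    have h1 : (x - y) ⬝ᵥ x = (x - y) ⬝ᵥ y := by
      simpa [expRidge, affineMap] using h
    have h2 : (x - y) ⬝ᵥ (x - y) = 0 := by rw [dotProduct_sub, h1, sub_self]
    exact Subtype.ext (sub_eq_zero.1 (dotProduct_self_eq_zero.1 h2))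
  have htop := ContinuousMap.subalgebra_topologicalClosure_eq_top_of_separatesPoints _ hsep
  rw [eq_top_iff]
  intro g _
  have hg : g ∈ (Algebra.adjoin ℝ (Set.range (expRidge K))).topologicalClosure := by
    rw [htop]; trivial
  exact closure_minimal (t := ((reluSpan K).topologicalClosure : Set C(K, ℝ)))
    (fun u hu => adjoin_expRidge_le_closure hu) (Submodule.isClosed_topologicalClosure _) hg

end UniversalApproximation

/-! ### Constructions with perceptrons -/

theorem MLP.eval_apply {ι κ : Type} [Fintype ι] (m : MLP ι κ) (x : ι → ℝ) (j : κ) :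
    m.eval x j = ∑ k, m.W₂ j k * max 0 (m.W₁ k ⬝ᵥ x + m.b₁ k) + m.b₂ j := rfl

theorem MLP.continuous_eval {ι κ : Type} [Fintype ι] (m : MLP ι κ) : Continuous m.eval := by
  refine continuous_pi fun j => ?_
  simp only [MLP.eval_apply, dotProduct]
  fun_prop

/-- A perceptron with hidden layer indexed by an arbitrary finite type. -/
theorem MLP.exists_of_fintype {ι κ η : Type} [Fintype ι] [Fintype η] (W₁ : η → ι → ℝ) (b₁ : η → ℝ)
    (W₂ : κ → η → ℝ) (b₂ : κ → ℝ) :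
    ∃ m : MLP ι κ, ∀ x j, m.eval x j = ∑ k, W₂ j k * max 0 (W₁ k ⬝ᵥ x + b₁ k) + b₂ j := by
  let e := Fintype.equivFin η
  refine ⟨⟨Fintype.card η, fun k => W₁ (e.symm k), fun k => b₁ (e.symm k),
    fun j k => W₂ j (e.symm k), b₂⟩, fun x j => ?_⟩
  rw [MLP.eval_apply]
  congr 1
  exact Equiv.sum_comp e.symm fun k => W₂ j k * max 0 (W₁ k ⬝ᵥ x + b₁ k)

/-- Perceptrons with scalar outputs can be stacked. -/
theorem MLP.exists_stack {ι κ : Type} [Fintype ι] [Fintype κ] (g : κ → MLP ι (Fin 1)) :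
    ∃ m : MLP ι κ, ∀ x j, m.eval x j = (g j).eval x 0 := by
  classical
  obtain ⟨m, hm⟩ := MLP.exists_of_fintype (κ := κ) (η := (j : κ) × Fin (g j).width)
    (fun k => (g k.1).W₁ k.2) (fun k => (g k.1).b₁ k.2)
    (fun j k => if k.1 = j then (g k.1).W₂ 0 k.2 else 0) (fun j => (g j).b₂ 0)
  refine ⟨m, fun x j => ?_⟩
  rw [hm, MLP.eval_apply, Fintype.sum_sigma, Finset.sum_eq_single j]
  · simp
  · intro b _ hb
    simp [hb]
  · simp

/-- Perceptrons can select coordinates exactly. -/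
theorem MLP.exists_select {ι κ : Type} [Fintype ι] [Fintype κ] (s : κ → ι) :
    ∃ m : MLP ι κ, ∀ x, m.eval x = fun j => x (s j) := by
  classical
  -- Two units per output: `t = max 0 t - max 0 (-t)`.
  obtain ⟨m, hm⟩ := MLP.exists_of_fintype (ι := ι) (κ := κ) (η := κ × Bool)
    (fun k => Pi.single (s k.1) (if k.2 then 1 else -1)) 0
    (fun j k => if k.1 = j then (if k.2 then 1 else -1) else 0) 0
  refine ⟨m, fun x => funext fun j => ?_⟩
  rw [hm, Fintype.sum_prod_type, Finset.sum_eq_single j]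
  · simp only [Fintype.sum_bool, single_dotProduct]
    rcases le_total 0 (x (s j)) with h | h
    · simp [h]
    · simp [h]
  · intro b _ hb
    simp [hb]
  · simp

/-- Universal approximation by perceptrons with scalar output. -/
theorem MLP.exists_approx {ι : Type} [Fintype ι] {K : Set (ι → ℝ)} (hK : IsCompact K)
    {g : (ι → ℝ) → ℝ} (hg : ContinuousOn g K) {ε : ℝ} (hε : 0 < ε) :
    ∃ m : MLP ι (Fin 1), ∀ x ∈ K, |m.eval x 0 - g x| < ε := by
  have := isCompact_iff_compactSpace.1 hK
  let G : C(K, ℝ) := ⟨K.domRestrict g, hg.domRestrict⟩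
  have hG : G ∈ (reluSpan K).topologicalClosure := by
    rw [reluSpan_topologicalClosure]; trivial
  obtain ⟨u, hu, hd⟩ := Metric.mem_closure_iff.1 hG ε hε
  obtain ⟨N, a, r, rfl⟩ := (Submodule.mem_span_set' ).1 hu
  choose p hp using fun i => (r i).2
  obtain ⟨m, hm⟩ := MLP.exists_of_fintype (ι := ι) (κ := Fin 1) (fun i => (p i).1)
    (fun i => (p i).2) (fun _ => a) 0
  refine ⟨m, fun x hx => ?_⟩
  have h1 := (ContinuousMap.dist_lt_iff hε).1 hd ⟨x, hx⟩
  rw [dist_comm, Real.dist_eq] at h1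
  have h2 : m.eval x 0 = (∑ i, a i • (r i : C(K, ℝ))) ⟨x, hx⟩ := by
    rw [hm]
    simp [← hp, reluRidge, affineMap]
  rw [h2]
  exact h1

/-! ### Stone–Weierstrass for pooled perceptrons -/

/-- Stone–Weierstrass without separation of points: a continuous function which is constant
on the sets of points that `S` does not distinguish is a limit of polynomials in elements of `S`. -/
theorem mem_topologicalClosure_adjoin {X : Type*} [TopologicalSpace X] [CompactSpace X]
    (S : Set C(X, ℝ)) (F : C(X, ℝ)) (hF : ∀ x y, (∀ g ∈ S, g x = g y) → F x = F y) :
    F ∈ (Algebra.adjoin ℝ S).topologicalClosure := by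
  let s : Setoid X :=
    ⟨fun x y => ∀ g ∈ S, g x = g y, fun _ _ _ => rfl, fun h g hg => (h g hg).symm,
      fun h h' g hg => (h g hg).trans (h' g hg)⟩
  let q : C(X, Quotient s) := ⟨Quotient.mk s, continuous_quotient_mk'⟩
  let lift (g : C(X, ℝ)) (hg : ∀ x y, s x y → g x = g y) : C(Quotient s, ℝ) :=
    ⟨Quotient.lift g hg, g.continuous.quotient_lift hg⟩
  let φ : C(Quotient s, ℝ) →ₐ[ℝ] C(X, ℝ) := ContinuousMap.compRightAlgHom ℝ ℝ q
  have hφ : Continuous φ := ContinuousMap.continuous_precomp q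
  -- On the quotient by indistinguishability, the functions pulling back into the algebra do
  -- separate points.
  let B : Subalgebra ℝ C(Quotient s, ℝ) := (Algebra.adjoin ℝ S).comap φ
  have hB : B.SeparatesPoints := by
    intro x y hxy
    induction x, y using Quotient.inductionOn₂ with | _ x y
    have hne : ¬ ∀ g ∈ S, g x = g y := fun h => hxy (Quotient.sound h)
    push Not at hne
    obtain ⟨g, hg, hgxy⟩ := hne
    refine ⟨_, ⟨lift g fun x y h => h g hg, ?_, rfl⟩, hgxy⟩
    exact Algebra.subset_adjoin hg
  have htop := ContinuousMap.subalgebra_topologicalClosure_eq_top_of_separatesPoints B hB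
  have h1 : lift F hF ∈ B.topologicalClosure := by rw [htop]; trivial
  exact map_mem_closure hφ h1 fun u hu => hu

/-- Families over a finite type which agree as multisets agree up to relabelling. -/
theorem exists_perm_of_sum_eq {ν E : Type*} [Fintype ν] [DecidableEq E] (h h' : ν → E)
    (H : ∀ p, ∑ v, (if h v = p then (1 : ℝ) else 0) = ∑ v, if h' v = p then (1 : ℝ) else 0) :
    ∃ σ : Equiv.Perm ν, ∀ v, h' v = h (σ v) := by
  have hcard : ∀ p, Nonempty ({v // h' v = p} ≃ {v // h v = p}) := fun p => by
    refine Fintype.card_eq.1 ?_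
    have := H p
    simp only [Finset.sum_boole, Nat.cast_inj] at this
    rw [Fintype.card_subtype, Fintype.card_subtype, this]
  exact ⟨Equiv.ofFiberEquiv fun p => (hcard p).some, fun v => (Equiv.ofFiberEquiv_map _ v).symm⟩

/-- Sums of perceptrons separate multisets of vectors. -/
theorem exists_perm_of_sum_eval_eq {ν ι : Type} [Fintype ν] [Fintype ι] (h h' : ν → ι → ℝ)
    (H : ∀ m : MLP ι (Fin 1), ∑ v, m.eval (h v) 0 = ∑ v, m.eval (h' v) 0) :
    ∃ σ : Equiv.Perm ν, ∀ v, h' v = h (σ v) := by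
  classical
  refine exists_perm_of_sum_eq h h' fun p => ?_
  have hfin : (Set.range h ∪ Set.range h').Finite :=
    (Set.finite_range h).union (Set.finite_range h')
  refine eq_of_forall_dist_le fun ε hε => ?_
  -- Only finitely many vectors occur, so the indicator of `p` is continuous on them and its sum
  -- counts multiplicity. The `+ 1` covers empty `ν`.
  obtain ⟨m, hm⟩ := MLP.exists_approx hfin.isCompact
    (g := fun x => if x = p then (1 : ℝ) else 0) (hfin.continuousOn _)
    (ε := ε / (2 * (Fintype.card ν + 1))) (by positivity)
  have key : ∀ u : ν → ι → ℝ, (∀ v, u v ∈ Set.range h ∪ Set.range h') →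
      |∑ v, m.eval (u v) 0 - ∑ v, (if u v = p then (1 : ℝ) else 0)| ≤ ε / 2 := fun u hu => by
    rw [← Finset.sum_sub_distrib]
    refine (Finset.abs_sum_le_sum_abs _ _).trans
      ((Finset.sum_le_sum fun v _ => (hm _ (hu v)).le).trans ?_)
    rw [Finset.sum_const, Finset.card_univ, nsmul_eq_mul, mul_div_assoc', div_le_iff₀ (by positivity)]
    nlinarith
  have h1 := abs_le.1 (key h fun v => .inl ⟨v, rfl⟩)
  have h2 := abs_le.1 (key h' fun v => .inr ⟨v, rfl⟩)
  rw [Real.dist_eq, abs_le]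
  have := H m
  constructor <;> linarith [h1.1, h1.2, h2.1, h2.2]

/-- A function of pooled scalar perceptrons, in the closure of the algebra they generate,
is approximated by a perceptron applied to finitely many of them. -/
theorem exists_mlp_of_mem_closure_adjoin {X J : Type*} [TopologicalSpace X] [CompactSpace X]
    (s : J → C(X, ℝ)) (F : C(X, ℝ))
    (hF : F ∈ (Algebra.adjoin ℝ (Set.range s)).topologicalClosure) {ε : ℝ} (hε : 0 < ε) :
    ∃ (k : ℕ) (j : Fin k → J) (ρ : MLP (Fin k) (Fin 1)),
      ∀ x, |ρ.eval (fun i => s (j i) x) 0 - F x| < ε := by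
  obtain ⟨u, hu, hd⟩ := Metric.mem_closure_iff.1 hF (ε / 2) (half_pos hε)
  rw [SetLike.mem_coe, Algebra.adjoin_range_eq_range_aeval] at hu
  obtain ⟨P, rfl⟩ := hu
  obtain ⟨k, j, -, Q, rfl⟩ := MvPolynomial.exists_fin_rename P
  have hcont : Continuous fun x i => s (j i) x :=
    continuous_pi fun i => (s (j i)).continuous
  obtain ⟨ρ, hρ⟩ := MLP.exists_approx (isCompact_range hcont)
    (MvPolynomial.continuous_eval Q).continuousOn (half_pos hε)
  refine ⟨k, j, ρ, fun x => ?_⟩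
  have h1 := hρ _ ⟨x, rfl⟩
  have h2 := (ContinuousMap.dist_lt_iff (half_pos hε)).1 hd x
  have h3 : (MvPolynomial.aeval s (MvPolynomial.rename j Q) : C(X, ℝ)) x =
      MvPolynomial.eval (fun i => s (j i) x) Q := by
    rw [MvPolynomial.aeval_rename]
    exact MvPolynomial.comp_aeval_apply (s ∘ j) (ContinuousMap.evalAlgHom ℝ ℝ x) Q
  rw [AlgHom.toRingHom_eq_coe, RingHom.coe_coe, h3, Real.dist_eq] at h2
  have := abs_lt.1 h1
  have := abs_lt.1 h2
  rw [abs_lt]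
  constructor <;> linarith

/-! ### Concentration of the Gram matrix -/

section GramMatrix

variable (μ : Measure ℝ) [IsProbabilityMeasure μ] (n d : ℕ)

instance isProbabilityMeasure_featureLaw : IsProbabilityMeasure (featureLaw μ n d) := by
  unfold featureLaw; infer_instance

theorem measurePreserving_entry (v : Fin n) (j : Fin d) :
    MeasurePreserving (fun R : Fin n → Fin d → ℝ => R v j) (featureLaw μ n d) μ :=
  (measurePreserving_eval (fun _ : Fin d => μ) j).comp
    (measurePreserving_eval (fun _ : Fin n => Measure.pi fun _ : Fin d => μ) v)

theorem iIndepFun_entry :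
    iIndepFun (fun (p : Fin n × Fin d) (R : Fin n → Fin d → ℝ) => R p.1 p.2)
      (featureLaw μ n d) := by
  have h := iIndepFun_uncurry_infinitePi' (ι := Fin n) (κ := Fin d) (X := fun _ _ x => x)
    (fun _ _ => μ) (fun _ _ => measurable_id)
  simp only [Measure.infinitePi_eq_pi] at h
  exact h

variable {μ n d}

theorem ae_entry_le {M : ℝ} (hM : ∀ᵐ x ∂μ, |x| ≤ M) :
    ∀ᵐ R ∂featureLaw μ n d, ∀ v j, |R v j| ≤ M :=
  ae_all_iff.2 fun v => ae_all_iff.2 fun j =>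
    (measurePreserving_entry μ n d v j).quasiMeasurePreserving.ae hM

theorem integral_entry_mul (hmean : ∫ x, x ∂μ = 0) {c : ℝ}
    (hvar : variance (fun x : ℝ => x) μ = c) (v w : Fin n) (j : Fin d) :
    ∫ R, R v j * R w j ∂featureLaw μ n d = (c • (1 : Matrix (Fin n) (Fin n) ℝ)) v w := by
  have hmp := measurePreserving_entry μ n d
  by_cases hvw : v = w
  · subst hvw
    have h1 : ∫ R, R v j * R v j ∂featureLaw μ n d = ∫ x, x * x ∂μ := by
      have := integral_map (hmp v j).aemeasurable (f := fun x => x * x) (by fun_prop)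
      rw [(hmp v j).map_eq] at this
      exact this.symm
    rw [h1, ← hvar, variance_of_integral_eq_zero aemeasurable_id' hmean]
    simp [sq]
  · have hind := (iIndepFun_entry μ n d).indepFun (i := (v, j)) (j := (w, j)) (by simp [hvw])
    have h1 : ∫ R, R v j ∂featureLaw μ n d = 0 := by
      have := integral_map (hmp v j).aemeasurable (f := fun x => x) (by fun_prop)
      rw [(hmp v j).map_eq] at this
      exact this.symm.trans hmean
    rw [hind.integral_fun_mul_eq_mul_integral (hmp v j).measurable.aestronglyMeasurable
      (hmp w j).measurable.aestronglyMeasurable, h1]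
    simp [hvw]

/-- Chebyshev's inequality: for fixed `v`, `w` the products `R v j * R w j` are pairwise independent
in `j`, and each has variance at most `M ^ 4`. -/
theorem measure_gram_deviation_le {M : ℝ} (hM : ∀ᵐ x ∂μ, |x| ≤ M) (hmean : ∫ x, x ∂μ = 0) {c : ℝ}
    (hvar : variance (fun x : ℝ => x) μ = c) (hd : 0 < d) {r : ℝ} (hr : 0 < r) (v w : Fin n) :
    (featureLaw μ n d).real {R | r ≤ |(d : ℝ)⁻¹ * ∑ j, R v j * R w j -
      (c • (1 : Matrix (Fin n) (Fin n) ℝ)) v w|} ≤ M ^ 4 / r ^ 2 / d := by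
  set P := featureLaw μ n d
  set a := (c • (1 : Matrix (Fin n) (Fin n) ℝ)) v w
  have hmp := measurePreserving_entry μ n d
  let Y (j : Fin d) (R : Fin n → Fin d → ℝ) : ℝ := R v j * R w j
  have hYm (j) : Measurable (Y j) := (hmp v j).measurable.mul (hmp w j).measurable
  have hYb (j) : ∀ᵐ R ∂P, |Y j R| ≤ M ^ 2 := by
    filter_upwards [ae_entry_le (n := n) (d := d) hM] with R hR
    rw [abs_mul, sq]
    exact mul_le_mul (hR v j) (hR w j) (abs_nonneg _) ((abs_nonneg _).trans (hR v j))
  have hYL (j) : MemLp (Y j) 2 P :=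
    MemLp.of_bound (hYm j).aestronglyMeasurable (M ^ 2) (hYb j)
  have hYv (j) : variance (Y j) P ≤ M ^ 4 := by
    have := variance_le_sq_of_bounded (a := -M ^ 2) (b := M ^ 2)
      ((hYb j).mono fun R h => abs_le.1 h) (hYm j).aemeasurable
    exact this.trans_eq (by ring)
  have hYi : Set.Pairwise (↑(Finset.univ : Finset (Fin d))) fun i j => Y i ⟂ᵢ[P] Y j :=
    fun i _ j _ hij => (iIndepFun_entry μ n d).indepFun_mul_mul
      (fun p => (hmp p.1 p.2).measurable) (v, i) (w, i) (v, j) (w, j)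
      (by simp [hij]) (by simp [hij]) (by simp [hij]) (by simp [hij])
  have hSv : variance (∑ j, Y j) P ≤ d * M ^ 4 := by
    rw [IndepFun.variance_sum (fun j _ => hYL j) hYi]
    exact (Finset.sum_le_sum fun j _ => hYv j).trans_eq (by simp)
  have hSL : MemLp (∑ j, Y j) 2 P := memLp_finsetSum' _ fun j _ => hYL j
  have hSE : P[∑ j, Y j] = d * a := by
    simp only [Finset.sum_apply]
    rw [integral_finsetSum _ fun j _ => (hYL j).integrable one_le_two]
    simp only [Y, P, integral_entry_mul hmean hvar]
    simp [a]
  have hd' : (0 : ℝ) < d := by exact_mod_cast hd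
  have hcheb := meas_ge_le_variance_div_sq hSL (c := d * r) (by positivity)
  rw [hSE] at hcheb
  have hset : {R : Fin n → Fin d → ℝ | r ≤ |(d : ℝ)⁻¹ * ∑ j, R v j * R w j - a|} =
      {R | d * r ≤ |(∑ j, Y j) R - d * a|} := by
    ext R
    have : (∑ j, Y j) R - d * a = d * ((d : ℝ)⁻¹ * ∑ j, R v j * R w j - a) := by
      rw [mul_sub, mul_inv_cancel_left₀ hd'.ne', Finset.sum_apply]
    rw [Set.mem_ofPred_eq, Set.mem_ofPred_eq, this, abs_mul, abs_of_pos hd',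
      mul_le_mul_iff_right₀ hd']
  rw [hset]
  refine (ENNReal.toReal_le_of_le_ofReal (by positivity [variance_nonneg (∑ j, Y j) P]) hcheb).trans ?_
  calc _ ≤ (d * M ^ 4) / (d * r) ^ 2 := by gcongr
    _ = _ := by field_simp

variable (n)

/-- With many random features the Gram matrix of the nodes is uniformly nondegenerate with high
probability. -/
theorem exists_det_gram_ge {M : ℝ} (hM : ∀ᵐ x ∂μ, |x| ≤ M) (hmean : ∫ x, x ∂μ = 0) {c : ℝ}
    (hc : 0 < c) (hvar : variance (fun x : ℝ => x) μ = c) {δ : ℝ} (hδ : 0 < δ) :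
    ∃ (d : ℕ) (η : ℝ), 0 < η ∧ 1 - δ < (featureLaw μ n d).real
      {R | (∀ v j, |R v j| ≤ M) ∧ η ≤ (Matrix.of R * (Matrix.of R).transpose).det} := by
  obtain ⟨r, hr, hrdet⟩ : ∃ r > 0, ∀ G : Matrix (Fin n) (Fin n) ℝ,
      (∀ v w, |G v w - (c • (1 : Matrix (Fin n) (Fin n) ℝ)) v w| < r) → c ^ n / 2 < G.det := by
    have hcont : Continuous fun G : Fin n → Fin n → ℝ => (Matrix.of G).det :=
      Continuous.matrix_det continuous_id
    have hopen : IsOpen {G : Fin n → Fin n → ℝ | c ^ n / 2 < (Matrix.of G).det} :=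
      isOpen_lt continuous_const hcont
    obtain ⟨r, hr, hball⟩ := Metric.isOpen_iff.1 hopen (c • (1 : Matrix (Fin n) (Fin n) ℝ)) (by
      change c ^ n / 2 < (c • (1 : Matrix (Fin n) (Fin n) ℝ)).det
      simp [hc])
    refine ⟨r, hr, fun G hG => hball ?_⟩
    exact (dist_pi_lt_iff hr).2 fun v => (dist_pi_lt_iff hr).2 fun w => hG v w
  -- Large enough for a union bound over the `n * n` entries; the `0` forces `d` to be positive.
  obtain ⟨d, hd⟩ := exists_nat_gt (max 0 (n * n * (M ^ 4 / r ^ 2) / δ))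
  have hd0 : (0 : ℝ) < d := (le_max_left _ _).trans_lt hd
  have hd1 := (le_max_right _ _).trans_lt hd
  -- The factor `d ^ n` undoes the normalisation by `d⁻¹` inside the determinant.
  refine ⟨d, d ^ n * (c ^ n / 2), by positivity, ?_⟩
  set P := featureLaw μ n d
  let a := (c • (1 : Matrix (Fin n) (Fin n) ℝ))
  let B (p : Fin n × Fin n) : Set (Fin n → Fin d → ℝ) :=
    {R | r ≤ |(d : ℝ)⁻¹ * ∑ j, R p.1 j * R p.2 j - a p.1 p.2|}
  have hB : P.real (⋃ p, B p) < δ := by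
    calc P.real (⋃ p, B p) ≤ ∑ p, P.real (B p) := measureReal_iUnion_fintype_le _
      _ ≤ ∑ p : Fin n × Fin n, M ^ 4 / r ^ 2 / d := Finset.sum_le_sum fun p _ =>
          measure_gram_deviation_le hM hmean hvar (by exact_mod_cast hd0) hr p.1 p.2
      _ = n * n * (M ^ 4 / r ^ 2) / d := by simp; ring
      _ < δ := by rwa [div_lt_comm₀ hd0 hδ]
  have hcover : P.real (⋃ p, B p)ᶜ ≤ P.real {R | (∀ v j, |R v j| ≤ M) ∧
      d ^ n * (c ^ n / 2) ≤ (Matrix.of R * (Matrix.of R).transpose).det} := by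
    refine ENNReal.toReal_mono (measure_ne_top _ _) (measure_mono_ae ?_)
    filter_upwards [ae_entry_le (n := n) (d := d) hM] with R hR hRB
    refine ⟨hR, ?_⟩
    have h1 := hrdet ((d : ℝ)⁻¹ • (Matrix.of R * (Matrix.of R).transpose)) fun v w => by
      by_contra! h
      refine hRB (Set.mem_iUnion.2 ⟨(v, w), ?_⟩)
      simpa [B, a, Matrix.mul_apply] using h
    rw [Matrix.det_smul, Fintype.card_fin, inv_pow, ← div_eq_inv_mul, lt_div_iff₀ (by positivity)] at h1
    linarith
  -- Subadditivity suffices, so measurability of `B` is not needed.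
  have hcompl : 1 ≤ P.real (⋃ p, B p) + P.real (⋃ p, B p)ᶜ := by
    have := measureReal_union_le (μ := P) (⋃ p, B p) (⋃ p, B p)ᶜ
    rwa [Set.union_compl_self, probReal_univ] at this
  linarith

end GramMatrix

/-! ### Node features computed by one layer -/

/-- The features `[X, R, A R]` of the nodes of a graph with random features `R`. -/
def nodeFeatures {n d₀ d : ℕ} (G : Graph n d₀) (R : Fin n → Fin d → ℝ) :
    Matrix (Fin n) ((Fin d₀ ⊕ Fin d) ⊕ Fin d) ℝ :=
  Matrix.fromCols (Matrix.fromCols G.1 (Matrix.of R)) (G.2 * Matrix.of R)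

theorem continuous_nodeFeatures {n d₀ d : ℕ} :
    Continuous fun p : Graph n d₀ × (Fin n → Fin d → ℝ) => nodeFeatures p.1 p.2 := by
  have hR : Continuous fun p : Graph n d₀ × (Fin n → Fin d → ℝ) => Matrix.of p.2 :=
    continuous_snd
  have hAR : Continuous fun p : Graph n d₀ × (Fin n → Fin d → ℝ) => p.1.2 * Matrix.of p.2 :=
    (continuous_snd.comp continuous_fst).matrix_mul hR
  refine continuous_pi fun v => continuous_pi fun i => ?_
  rcases i with (i | i) | i
  · exact (continuous_fst.comp continuous_fst).matrix_elem v i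
  · exact hR.matrix_elem v i
  · exact hAR.matrix_elem v i

/-- One message passing layer can compute the features `[X, R, A R]`, in any enumeration. -/
theorem MessagePassing.exists_nodeFeatures {n d₀ d h : ℕ}
    (e : Fin h → (Fin d₀ ⊕ Fin d) ⊕ Fin d) :
    ∃ L : MessagePassing (Fin d₀ ⊕ Fin d) (Fin h), ∀ (G : Graph n d₀) (R : Fin n → Fin d → ℝ) v,
      L.eval G.2 (Matrix.fromCols G.1 (Matrix.of R)) v = fun i => nodeFeatures G R v (e i) := by
  obtain ⟨msg, hmsg⟩ := MLP.exists_select (Sum.inr : Fin d → Fin d₀ ⊕ Fin d)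
  obtain ⟨upd, hupd⟩ := MLP.exists_select e
  refine ⟨⟨d, msg, upd⟩, fun G R v => ?_⟩
  have h : msg.rowwise (Matrix.fromCols G.1 (Matrix.of R)) = Matrix.of R := by
    ext w j
    simp [MLP.rowwise, hmsg]
  change upd.eval (Matrix.fromCols (Matrix.fromCols G.1 (Matrix.of R))
    (G.2 * msg.rowwise (Matrix.fromCols G.1 (Matrix.of R))) v) = _
  rw [h, hupd]
  rfl

/-- Pooled perceptrons of the features `[X, R, A R]`, followed by a perceptron, form a random
graph neural network. -/
theorem exists_gnn {d₀ d k : ℕ} (n : ℕ)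
    (g : Fin k → MLP ((Fin d₀ ⊕ Fin d) ⊕ Fin d) (Fin 1)) (ρ : MLP (Fin k) (Fin 1)) :
    ∃ N : GNN (Fin d₀ ⊕ Fin d), ∀ (G : Graph n d₀) (R : Fin n → Fin d → ℝ),
      rgnn N G R = ρ.eval (fun i => ∑ v, (g i).eval (nodeFeatures G R v) 0) 0 := by
  let e := (Fintype.equivFin ((Fin d₀ ⊕ Fin d) ⊕ Fin d)).symm
  obtain ⟨L, hL⟩ := MessagePassing.exists_nodeFeatures (n := n) e
  have hg : ∀ i, ∃ m : MLP (Fin (Fintype.card ((Fin d₀ ⊕ Fin d) ⊕ Fin d))) (Fin 1),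
      ∀ x, m.eval (fun i => x (e i)) 0 = (g i).eval x 0 := fun i => by
    refine ⟨⟨(g i).width, (g i).W₁.submatrix id e, (g i).b₁, (g i).W₂, (g i).b₂⟩, fun x => ?_⟩
    rw [MLP.eval_apply, MLP.eval_apply]
    congr! 5 with k
    exact Equiv.sum_comp e fun l => (g i).W₁ k l * x l
  choose g' hg' using hg
  obtain ⟨φ, hφ⟩ := MLP.exists_stack g'
  refine ⟨⟨_, L, ⟨k, φ, ρ⟩⟩, fun G R => ?_⟩
  change ρ.eval (∑ v, φ.eval (L.eval G.2 (Matrix.fromCols G.1 (Matrix.of R)) v)) 0 = _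
  congr 2
  ext i
  rw [Finset.sum_apply]
  refine Finset.sum_congr rfl fun v _ => ?_
  rw [hL, hφ, hg']

/-- A graph is determined up to relabelling by the multiset of the features `[X, R, A R]` of its
nodes if the rows of `R` are linearly independent. -/
theorem eq_permute_of_nodeFeatures {n d₀ d : ℕ} {G G' : Graph n d₀} {R R' : Fin n → Fin d → ℝ}
    (hdet : (Matrix.of R' * (Matrix.of R').transpose).det ≠ 0) {σ : Equiv.Perm (Fin n)}
    (h : ∀ v, nodeFeatures G' R' v = nodeFeatures G R (σ v)) : G' = G.permute σ := by
  have hX (v i) : G'.1 v i = G.1 (σ v) i := congrFun (h v) (.inl (.inl i))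
  have hR (v j) : R' v j = R (σ v) j := congrFun (h v) (.inl (.inr j))
  have hAR (v j) : (G'.2 * Matrix.of R') v j = (G.2 * Matrix.of R) (σ v) j :=
    congrFun (h v) (.inr j)
  have h1 : G'.2 * Matrix.of R' = G.2.submatrix σ σ * Matrix.of R' := by
    ext v j
    rw [hAR, Matrix.mul_apply, Matrix.mul_apply]
    simp only [Matrix.submatrix_apply, Matrix.of_apply, hR]
    exact (Equiv.sum_comp σ fun w => G.2 (σ v) w * R w j).symm
  have h2 : G'.2 = G.2.submatrix σ σ := by
    -- Multiplying by `R'ᵀ` turns `R'` into its invertible Gram matrix, which cancels.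
    have h3 := congrArg (· * (Matrix.of R').transpose) h1
    simp only [Matrix.mul_assoc] at h3
    have := Matrix.invertibleOfIsUnitDet _ hdet.isUnit
    exact (Matrix.mul_left_inj_of_invertible _).1 h3
  exact Prod.ext (Matrix.ext hX) h2

end RGNN

end

/-! ### Universality in probability -/

theorem proposition1 (n d₀ : ℕ)
    -- a compact set of graphs of fixed size and a continuous graph function on it
    (Ω : Set (RGNN.Graph n d₀)) (hΩ : IsCompact Ω)
    (f : RGNN.Graph n d₀ → ℝ) (hf : ContinuousOn f Ω)
    (hinv : ∀ σ : Equiv.Perm (Fin n), ∀ G ∈ Ω, RGNN.Graph.permute σ G ∈ Ω →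
      f (RGNN.Graph.permute σ G) = f G)
    -- a bounded distribution with zero mean and (nonzero) variance
    (μ : MeasureTheory.Measure ℝ) [MeasureTheory.IsProbabilityMeasure μ]
    (hbdd : ∃ M : ℝ, ∀ᵐ x ∂μ, |x| ≤ M)
    (hmean : ∫ x, x ∂μ = 0)
    (c : ℝ) (hc : 0 < c) (hvar : ProbabilityTheory.variance (fun x : ℝ => x) μ = c)
    (ε δ : ℝ) (hε : 0 < ε) (hδ : 0 < δ) :
    ∃ (d : ℕ) (N : RGNN.GNN (Fin d₀ ⊕ Fin d)), ∀ G ∈ Ω,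
      1 - δ < (RGNN.featureLaw μ n d).real
        {R : Fin n → Fin d → ℝ | |RGNN.rgnn N G R - f G| < ε} := by
  obtain ⟨M, hM⟩ := hbdd
  obtain ⟨d, η, hη, hprob⟩ := RGNN.exists_det_gram_ge n hM hmean hc hvar hδ
  -- The bound `η ≤ det`, unlike `det ≠ 0`, is a closed condition and keeps this set compact.
  let good : Set (Fin n → Fin d → ℝ) :=
    {R | (∀ v j, |R v j| ≤ M) ∧ η ≤ (Matrix.of R * (Matrix.of R).transpose).det}
  have hgood : IsCompact good := by
    have hdet : IsClosed {R : Fin n → Fin d → ℝ |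
        η ≤ (Matrix.of R * (Matrix.of R).transpose).det} := by
      have hR : Continuous fun R : Fin n → Fin d → ℝ => Matrix.of R := continuous_id
      exact isClosed_le continuous_const (hR.matrix_mul hR.matrix_transpose).matrix_det
    refine ((isCompact_univ_pi fun _ : Fin n => isCompact_univ_pi fun _ : Fin d =>
      isCompact_Icc (a := -M) (b := M)).inter_right hdet).of_isClosed_subset ?_ ?_
    · refine IsClosed.inter ?_ hdet
      have : {R : Fin n → Fin d → ℝ | ∀ v j, |R v j| ≤ M} = ⋂ v, ⋂ j, {R | |R v j| ≤ M} := by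
        ext R; simp
      change IsClosed {R : Fin n → Fin d → ℝ | ∀ v j, |R v j| ≤ M}
      rw [this]
      exact isClosed_iInter fun v => isClosed_iInter fun j =>
        isClosed_le (by fun_prop) continuous_const
    · exact fun R hR => ⟨fun v _ j _ => abs_le.1 (hR.1 v j), hR.2⟩
  let X : Set (RGNN.Graph n d₀ × (Fin n → Fin d → ℝ)) := Ω ×ˢ good
  have : CompactSpace X := isCompact_iff_compactSpace.1 (hΩ.prod hgood)
  let F : C(X, ℝ) := ⟨fun p => f p.1.1,
    hf.comp_continuous (continuous_fst.comp continuous_subtype_val) fun p => p.2.1⟩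
  let s (m : RGNN.MLP ((Fin d₀ ⊕ Fin d) ⊕ Fin d) (Fin 1)) : C(X, ℝ) :=
    ⟨fun p => ∑ v, m.eval (RGNN.nodeFeatures p.1.1 p.1.2 v) 0,
      continuous_finsetSum _ fun v _ => (continuous_apply 0).comp <| m.continuous_eval.comp <|
        (continuous_apply v).comp (RGNN.continuous_nodeFeatures.comp continuous_subtype_val)⟩
  have hF : F ∈ (Algebra.adjoin ℝ (Set.range s)).topologicalClosure := by
    refine RGNN.mem_topologicalClosure_adjoin _ F fun p q hpq => ?_
    obtain ⟨σ, hσ⟩ := RGNN.exists_perm_of_sum_eval_eq (RGNN.nodeFeatures p.1.1 p.1.2)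
      (RGNN.nodeFeatures q.1.1 q.1.2) fun m => hpq _ ⟨m, rfl⟩
    have h := RGNN.eq_permute_of_nodeFeatures (hη.trans_le q.2.2.2).ne' hσ
    -- The relabelled graph lies in `Ω` because it is the graph of `q`.
    have h' := hinv σ p.1.1 p.2.1 (h ▸ q.2.1)
    rw [← h] at h'
    exact h'.symm
  obtain ⟨k, g, ρ, hρ⟩ := RGNN.exists_mlp_of_mem_closure_adjoin s F hF hε
  obtain ⟨N, hN⟩ := RGNN.exists_gnn n g ρ
  refine ⟨d, N, fun G hG => hprob.trans_le (MeasureTheory.measureReal_mono fun R hR => ?_)⟩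
  have := hρ ⟨(G, R), hG, hR⟩
  rw [Set.mem_ofPred_eq, hN]
  exact this
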